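/- Let $(W,S)$ be a Coxeter system with $S\neq\varnothing$, and let $\Gamma$ be a group with a root group datum (RGD system) $(\Gamma,(U_\alpha)_{\alpha\in\Phi},T)$ of type $(W,S)$, where $\Phi$ is the set of roots of $(W,S)$. Let $X=(X_+,X_-)$ be the associated twin building: with $B_\pm=T\langle U_\alpha : \alpha\in\Phi_\pm\rangle$, its chamber sets are $X_\pm=\Gamma/B_\pm$, and its Weyl distances and codistance are given by $\delta_\pm(gB_\pm,hB_\pm)=w \iff g^{-1}h\in B_\pm wB_\pm$ and $\delta^*(gB_+,hB_-)=w\iff g^{-1}h\in B_+wB_-$. (This is the situation of every twin building lattice $\Gamma<G_+\times G_-$ coming from a root group datum; no finiteness or lattice condition is needed.) Let $d_{X_\pm}$ be the combinatorial (gallery) distance on the chambers of $X_\pm$, and put $d_X\big((x_+,x_-),(y_+,y_-)\big)=d_{X_+}(x_+,y_+)+d_{X_-}(x_-,y_-)$. Two pairs $(x_+,x_-)$, $(y_+,y_-)$ are adjacent if for some $s\in S$ both $x_+,y_+$ and $x_-,y_-$ are $s$-adjacent, where a chamber counts as $s$-adjacent to itself. Let $c=(c_+,c_-)$ be any pair of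 opposite chambers (that is, $\delta^*(c_+,c_-)=1$), let $\Sigma$ be the set of all $\gamma\in\Gamma$ such that $\gamma c=(\gamma c_+,\gamma c_-)$ is adjacent to $c$, let $|\cdot|_\Sigma$ be the word length with respect to $\Sigma$, and let $d_\Sigma(\gamma,\gamma')=|\gamma^{-1}\gamma'|_\Sigma$. Then: 1. $\Sigma$ generates $\Gamma$. 2. For every $\gamma\in\Gamma$ one has $\tfrac12\, d_X(c,\gamma c)\le|\gamma|_\Sigma$. If $\gamma c\neq c$, then also $|\gamma|_\Sigma\le 2\,d_X(c,\gamma c)$. If $\gamma c=c$, then $|\gamma|_\Sigma\le 1$. 3. The orbit map $\Gamma\to X_+\times X_-$, $\gamma\mapsto\gamma c$, is a quasi-isometric embedding of $(\Gamma,d_\Sigma)$ into $(X_+\times X_-,d_X)$: there are constants $L\ge1$, $A\ge0$ with $L^{-1}d_\Sigma(\gamma,\gamma')-A\le d_X(\gamma c,\gamma' c)\le L\,d_\Sigma(\gamma,\gamma')+A$ for all $\gamma,\gamma'\in\Gamma$. -/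

import Mathlib

open scoped Pointwise

/-! ## Buildings and twin buildings of type `(W, S)`, as `W`-metric spaces

`cs : CoxeterSystem M W` is the Coxeter system, `cs.simple i` (for `i : I`) are its canonical
generators, and `cs.length` is its word length. -/

/-- A building of type `(W, S)` with set of chambers `C` and Weyl distance `δ`. -/
structure Building {I W : Type*} [Group W] {M : CoxeterMatrix I} (cs : CoxeterSystem M W)
    (C : Type*) where
  δ : C → C → W
  nonempty : Nonempty C
  δ_eq_one_iff : ∀ x y, δ x y = 1 ↔ x = y
  δ_step : ∀ x y x' i, δ x' x = cs.simple i →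
    δ x' y = cs.simple i * δ x y ∨ δ x' y = δ x y
  δ_step_of_lt : ∀ x y x' i, δ x' x = cs.simple i →
    cs.length (cs.simple i * δ x y) = cs.length (δ x y) + 1 →
    δ x' y = cs.simple i * δ x y
  exists_δ_step : ∀ x y i, ∃ x', δ x' x = cs.simple i ∧ δ x' y = cs.simple i * δ x y

namespace Building

variable {I W : Type*} [Group W] {M : CoxeterMatrix I} {cs : CoxeterSystem M W} {C : Type*}

/-- Two chambers are `s`-adjacent if they lie in a common `s`-panel; a chamber is `s`-adjacent
to itself. -/
def SAdjacent (X : Building cs C) (i : I) (x y : C) : Prop :=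
  x = y ∨ X.δ x y = cs.simple i

/-- The chamber graph: distinct chambers are joined if they are `s`-adjacent for some `s`. -/
def chamberGraph (X : Building cs C) : SimpleGraph C :=
  SimpleGraph.fromRel fun x y => ∃ i, X.SAdjacent i x y

/-- The combinatorial distance of two chambers: the length of a minimal gallery joining them. -/
noncomputable def dist (X : Building cs C) (x y : C) : ℕ :=
  X.chamberGraph.dist x y

end Building

/-- A twin building of type `(W, S)` with sets of chambers `P` (positive) and `N` (negative).
The codistance is recorded as `codist x y = δ*(x, y)` for `x` positive and `y` negative; the
codistance of a negative and a positive chamber is `δ*(y, x) = (codist x y)⁻¹`, so that the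
twinning axioms for a change of the negative chamber are written with multiplication from the
right. -/
structure TwinBuilding {I W : Type*} [Group W] {M : CoxeterMatrix I} (cs : CoxeterSystem M W)
    (P N : Type*) where
  pos : Building cs P
  neg : Building cs N
  codist : P → N → W
  codist_pos_step : ∀ x x' y i, pos.δ x' x = cs.simple i →
    cs.length (cs.simple i * codist x y) < cs.length (codist x y) →
    codist x' y = cs.simple i * codist x y
  codist_neg_step : ∀ x y y' i, neg.δ y' y = cs.simple i →
    cs.length (codist x y * cs.simple i) < cs.length (codist x y) →
    codist x y' = codist x y * cs.simple i
  exists_codist_pos_step : ∀ x y i, ∃ x', pos.δ x' x = cs.simple i ∧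
    codist x' y = cs.simple i * codist x y
  exists_codist_neg_step : ∀ x y i, ∃ y', neg.δ y' y = cs.simple i ∧
    codist x y' = codist x y * cs.simple i

namespace TwinBuilding

variable {I W : Type*} [Group W] {M : CoxeterMatrix I} {cs : CoxeterSystem M W} {P N : Type*}

/-- The pair `c = (c₊, c₋)` is a pair of opposite chambers. -/
def Opp (X : TwinBuilding cs P N) (c : P × N) : Prop :=
  X.codist c.1 c.2 = 1

/-- Two pairs are adjacent if, for one and the same `s`, their positive chambers are
`s`-adjacent and their negative chambers are `s`-adjacent. -/
def Adjacent (X : TwinBuilding cs P N) (x y : P × N) : Prop :=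
  ∃ i, X.pos.SAdjacent i x.1 y.1 ∧ X.neg.SAdjacent i x.2 y.2

/-- `d_X`, the sum of the combinatorial distances in the two halves. -/
noncomputable def dist (X : TwinBuilding cs P N) (x y : P × N) : ℕ :=
  X.pos.dist x.1 y.1 + X.neg.dist x.2 y.2

/-- The elements of `Γ` that move the pair `c` to a pair adjacent to `c`. -/
def adaptedGenerators (X : TwinBuilding cs P N) (Γ : Type*) [Group Γ] [MulAction Γ P]
    [MulAction Γ N] (c : P × N) : Set Γ :=
  {γ | X.Adjacent (γ • c) c}

end TwinBuilding

/-! ## Roots of a Coxeter system -/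

namespace CoxeterSystem

variable {I W : Type*} [Group W] {M : CoxeterMatrix I} (cs : CoxeterSystem M W)

/-- The simple root `α_s`, as a half-space of `W`. The opposite of a root is its complement. -/
def simpleRoot (i : I) : Set W :=
  {w | cs.length w < cs.length (cs.simple i * w)}

/-- The roots are the translates `w α_s` of the simple roots. -/
def IsRoot (α : Set W) : Prop :=
  ∃ (w : W) (i : I), α = w • cs.simpleRoot i

/-- A pair of roots is prenilpotent if the two roots have a common element and their opposites
have a common element. -/
def Prenilpotent (α β : Set W) : Prop :=
  cs.IsRoot α ∧ cs.IsRoot β ∧ (α ∩ β).Nonempty ∧ (αᶜ ∩ βᶜ).Nonempty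

/-- The open interval `(α, β)` of roots. -/
def rootInterval (α β : Set W) : Set (Set W) :=
  {γ | cs.IsRoot γ ∧ α ∩ β ⊆ γ ∧ αᶜ ∩ βᶜ ⊆ γᶜ ∧ γ ≠ α ∧ γ ≠ β}

end CoxeterSystem

/-! ## Root group data -/

/-- A root group datum (RGD system) of type `(W, S)` for the group `Γ`: root groups `U α`, one for
each root `α` (the values of `U` at other subsets of `W` play no role), and a subgroup `T`. For
`u ≠ 1` in the root group of the simple root `α_s`, `m i u` is the element `m(u)` of
`U_{-α_s} u U_{-α_s}` that permutes the root groups as `s` permutes the roots. -/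
structure RootGroupDatum {I W : Type*} [Group W] {M : CoxeterMatrix I} (cs : CoxeterSystem M W)
    (Γ : Type*) [Group Γ] where
  U : Set W → Subgroup Γ
  T : Subgroup Γ
  m : I → Γ → Γ
  U_ne_bot : ∀ α, cs.IsRoot α → U α ≠ ⊥
  commutator_le : ∀ α β, cs.Prenilpotent α β → α ≠ β →
    ⁅U α, U β⁆ ≤ ⨆ γ ∈ cs.rootInterval α β, U γ
  m_mem : ∀ i, ∀ u ∈ U (cs.simpleRoot i), u ≠ 1 →
    ∃ v ∈ U (cs.simpleRoot i)ᶜ, ∃ v' ∈ U (cs.simpleRoot i)ᶜ, m i u = v * u * v'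
  m_conj : ∀ i, ∀ u ∈ U (cs.simpleRoot i), u ≠ 1 → ∀ α, cs.IsRoot α → ∀ x,
    x ∈ U α ↔ m i u * x * (m i u)⁻¹ ∈ U (cs.simple i • α)
  m_inv_mul_m_mem : ∀ i, ∀ u ∈ U (cs.simpleRoot i), u ≠ 1 →
    ∀ v ∈ U (cs.simpleRoot i), v ≠ 1 → (m i u)⁻¹ * m i v ∈ T
  not_le : ∀ i, ¬ U (cs.simpleRoot i)ᶜ ≤ ⨆ α ∈ {α | cs.IsRoot α ∧ 1 ∈ α}, U α
  generate : T ⊔ ⨆ α ∈ {α | cs.IsRoot α}, U α = ⊤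
  T_normalizes : ∀ t ∈ T, ∀ α, cs.IsRoot α → ∀ x ∈ U α, t * x * t⁻¹ ∈ U α

namespace RootGroupDatum

variable {I W : Type*} [Group W] {M : CoxeterMatrix I} {cs : CoxeterSystem M W}
  {Γ : Type*} [Group Γ]

/-- `B₊ = T U₊`, where `U₊` is generated by the root groups of the positive roots (those that
contain `1`). -/
def Bpos (R : RootGroupDatum cs Γ) : Subgroup Γ :=
  R.T ⊔ ⨆ α ∈ {α | cs.IsRoot α ∧ 1 ∈ α}, R.U α

/-- `B₋ = T U₋`, where `U₋` is generated by the root groups of the negative roots. -/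
def Bneg (R : RootGroupDatum cs Γ) : Subgroup Γ :=
  R.T ⊔ ⨆ α ∈ {α | cs.IsRoot α ∧ 1 ∉ α}, R.U α

/-- `R.Represents n w`: the element `n` of the group generated by `T` and the `m(u)` represents
the element `w` of the Weyl group (`T` represents `1` and the `m(u)` represent `s`). -/
inductive Represents (R : RootGroupDatum cs Γ) : Γ → W → Prop
  | torus (t : Γ) (ht : t ∈ R.T) : Represents R t 1
  | mul_m (n : Γ) (w : W) (hn : Represents R n w) (i : I) (u : Γ)
      (hu : u ∈ R.U (cs.simpleRoot i)) (hu1 : u ≠ 1) :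
      Represents R (n * R.m i u) (w * cs.simple i)

/-- The double coset `B w B'`. -/
def doubleCoset (R : RootGroupDatum cs Γ) (B : Subgroup Γ) (w : W) (B' : Subgroup Γ) : Set Γ :=
  {g | ∃ b ∈ B, ∃ n, R.Represents n w ∧ ∃ b' ∈ B', g = b * n * b'}

/-- `X` is the twin building associated with the root group datum, with fundamental pair `o`:
`Γ` acts on `X` so that `X₊ = Γ / B₊` and `X₋ = Γ / B₋` with base chambers `o₊` and `o₋`, and the
Weyl distances and the codistance are those defined by the Bruhat and Birkhoff double cosets. -/
structure IsAssociated (R : RootGroupDatum cs Γ) {P N : Type*} [MulAction Γ P] [MulAction Γ N]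
    (X : TwinBuilding cs P N) (o : P × N) : Prop where
  exists_smul_pos : ∀ x : P, ∃ g : Γ, g • o.1 = x
  exists_smul_neg : ∀ y : N, ∃ g : Γ, g • o.2 = y
  stabilizer_pos : MulAction.stabilizer Γ o.1 = R.Bpos
  stabilizer_neg : MulAction.stabilizer Γ o.2 = R.Bneg
  δ_pos : ∀ (g h : Γ) (w : W),
    X.pos.δ (g • o.1) (h • o.1) = w ↔ g⁻¹ * h ∈ R.doubleCoset R.Bpos w R.Bpos
  δ_neg : ∀ (g h : Γ) (w : W),
    X.neg.δ (g • o.2) (h • o.2) = w ↔ g⁻¹ * h ∈ R.doubleCoset R.Bneg w R.Bneg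
  codist : ∀ (g h : Γ) (w : W),
    X.codist (g • o.1) (h • o.2) = w ↔ g⁻¹ * h ∈ R.doubleCoset R.Bpos w R.Bneg

end RootGroupDatum

/-! ## Word length and quasi-isometric embeddings -/

/-- The word length of `g` with respect to `A`: the least length of a word in the elements of `A`
and their inverses with product `g` (meaningful when `A` generates the group). -/
noncomputable def wordLength {Γ : Type*} [Group Γ] (A : Set Γ) (g : Γ) : ℕ :=
  sInf {n | ∃ l : List Γ, (∀ a ∈ l, a ∈ A ∨ a⁻¹ ∈ A) ∧ l.prod = g ∧ l.length = n}

/-- The map `f` is a quasi-isometric embedding for the distance functions `d` and `d'`. -/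
def IsQuasiIsometricEmbedding {α β : Type*} (d : α → α → ℝ) (d' : β → β → ℝ) (f : α → β) : Prop :=
  ∃ L A : ℝ, 1 ≤ L ∧ 0 ≤ A ∧ ∀ a b,
    L⁻¹ * d a b - A ≤ d' (f a) (f b) ∧ d' (f a) (f b) ≤ L * d a b + A

/-! `Γ` preserves distances and codistance and is transitive on opposite pairs, since `B₊ 1 B₋ =
B₊B₋`. Hence words in `Σ` trace chains of opposite pairs with consecutive pairs adjacent, and
conversely (`exists_word_of_oppChain`). Each link costs at most 2 in `d_X`, which gives the lower
bound on word length.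

The upper bound is `exists_oppChain`. To go from `(x, z)` to `(y, z')`, move the positive chamber
along a minimal gallery to `y`; the negative one follows in the same panels and ends at some `z₁`
with `d(z, z₁) ≤ d(x, y)`. Then move the negative chamber from `z₁` to `z'`; the positive one leaves
`y` but keeps `δ(p, y) = δ*(y, ·)⁻¹` (`exists_follow`), so it is back at `y` when the negative
chamber reaches `z'`, which is opposite `y`. -/

namespace CoxeterSystem

variable {I W : Type*} [Group W] {M : CoxeterMatrix I} (cs : CoxeterSystem M W)

theorem simple_ne_one (i : I) : cs.simple i ≠ 1 := by
  intro h
  have := cs.length_simple i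
  rw [h, cs.length_one] at this
  omega

end CoxeterSystem

/-! ### Adjacency and gallery distance in one building. -/

namespace Building

variable {I W : Type*} [Group W] {M : CoxeterMatrix I} {cs : CoxeterSystem M W} {C : Type*}
  (X : Building cs C)

theorem δ_self (x : C) : X.δ x x = 1 := (X.δ_eq_one_iff x x).2 rfl

theorem δ_eq_simple_symm {x y : C} {i : I} (h : X.δ x y = cs.simple i) :
    X.δ y x = cs.simple i := by
  rcases X.δ_step y x x i h with h' | h'
  · rw [X.δ_self] at h'
    rw [eq_comm, mul_eq_one_iff_inv_eq] at h'
    rw [← h', cs.inv_simple]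
  · rw [X.δ_self] at h'
    have : y = x := (X.δ_eq_one_iff y x).1 h'.symm
    subst this
    exact absurd (h.symm.trans (X.δ_self y)) (cs.simple_ne_one i)

theorem eq_or_δ_eq_simple {x y z : C} {i : I} (hxy : X.δ x y = cs.simple i)
    (hyz : X.δ y z = cs.simple i) : x = z ∨ X.δ x z = cs.simple i := by
  rcases X.δ_step y z x i hxy with h | h
  · left
    rw [hyz, cs.simple_mul_simple_self] at h
    exact (X.δ_eq_one_iff _ _).1 h
  · exact Or.inr (h.trans hyz)

theorem SAdjacent.symm {X : Building cs C} {x y : C} {i : I} (h : X.SAdjacent i x y) :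
    X.SAdjacent i y x :=
  h.imp Eq.symm X.δ_eq_simple_symm

theorem chamberGraph_adj_iff {x y : C} :
    X.chamberGraph.Adj x y ↔ ∃ i, X.δ x y = cs.simple i := by
  constructor
  · rintro ⟨hne, ⟨i, h | h⟩ | ⟨i, h | h⟩⟩
    · exact absurd h hne
    · exact ⟨i, h⟩
    · exact absurd h.symm hne
    · exact ⟨i, X.δ_eq_simple_symm h⟩
  · rintro ⟨i, h⟩
    refine ⟨?_, Or.inl ⟨i, Or.inr h⟩⟩
    rintro rfl
    exact cs.simple_ne_one i (h.symm.trans (X.δ_self x))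

/-- Left descent: from `x`, one can move to an adjacent chamber closer to `y`. -/
theorem exists_δ_step_lt {x y : C} (h : x ≠ y) :
    ∃ i x', X.δ x' x = cs.simple i ∧ X.δ x' y = cs.simple i * X.δ x y ∧
      cs.length (X.δ x' y) < cs.length (X.δ x y) := by
  have hne : X.δ x y ≠ 1 := fun h' => h ((X.δ_eq_one_iff x y).1 h')
  obtain ⟨i, hi⟩ := cs.exists_leftDescent_of_ne_one hne
  obtain ⟨x', h1, h2⟩ := X.exists_δ_step x y i
  exact ⟨i, x', h1, h2, by rw [h2]; exact hi⟩

theorem chamberGraph_preconnected : X.chamberGraph.Preconnected := by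
  have key : ∀ (n : ℕ) (x y : C), cs.length (X.δ x y) = n → X.chamberGraph.Reachable x y := by
    intro n
    induction n using Nat.strong_induction_on with
    | _ n ih =>
      intro x y hn
      by_cases h : x = y
      · rw [h]
      · obtain ⟨i, x', h1, -, h3⟩ := X.exists_δ_step_lt h
        have hadj : X.chamberGraph.Adj x x' :=
          X.chamberGraph_adj_iff.2 ⟨i, X.δ_eq_simple_symm h1⟩
        exact hadj.reachable.trans (ih _ (hn ▸ h3) x' y rfl)
  exact fun x y => key _ x y rfl

theorem dist_triangle (x y z : C) : X.dist x z ≤ X.dist x y + X.dist y z :=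
  haveI := X.nonempty
  SimpleGraph.Connected.dist_triangle ⟨X.chamberGraph_preconnected⟩

theorem dist_comm (x y : C) : X.dist x y = X.dist y x := SimpleGraph.dist_comm

theorem dist_self (x : C) : X.dist x x = 0 := SimpleGraph.dist_self

theorem exists_walk_length_eq_dist (x y : C) :
    ∃ p : X.chamberGraph.Walk x y, p.length = X.dist x y :=
  (X.chamberGraph_preconnected x y).exists_walk_length_eq_dist

theorem dist_le_one_of_sAdjacent {x y : C} {i : I} (h : X.SAdjacent i x y) : X.dist x y ≤ 1 := by
  rcases h with rfl | h
  · simp [X.dist_self]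
  · exact (SimpleGraph.dist_eq_one_iff_adj.2 (X.chamberGraph_adj_iff.2 ⟨i, h⟩)).le

theorem dist_map_le {f : C → C} (hf : ∀ x y, X.δ (f x) (f y) = X.δ x y) (x y : C) :
    X.dist (f x) (f y) ≤ X.dist x y := by
  obtain ⟨p, hp⟩ := X.exists_walk_length_eq_dist x y
  let F : X.chamberGraph →g X.chamberGraph :=
    ⟨f, fun h => by
      rw [chamberGraph_adj_iff] at h ⊢
      simpa only [hf] using h⟩
  rw [← hp, ← SimpleGraph.Walk.length_map F p]
  exact SimpleGraph.dist_le _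

theorem dist_smul {Γ : Type*} [Group Γ] [MulAction Γ C]
    (h : ∀ (g : Γ) (x y : C), X.δ (g • x) (g • y) = X.δ x y) (g : Γ) (x y : C) :
    X.dist (g • x) (g • y) = X.dist x y := by
  refine le_antisymm (X.dist_map_le (h g) x y) ?_
  simpa using X.dist_map_le (h g⁻¹) (g • x) (g • y)

end Building

/-! ### Codistance and chains of opposite pairs. -/

namespace TwinBuilding

variable {I W : Type*} [Group W] {M : CoxeterMatrix I} {cs : CoxeterSystem M W} {P N : Type*}
  (X : TwinBuilding cs P N)

/-- If `s` lengthens the codistance, some `x''` in the panel attains the longer value; every other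
chamber of the panel is one shortening step from `x''`, hence has the old value. -/
theorem codist_pos_eq_or {x x' : P} {i : I} (y : N) (h : X.pos.δ x' x = cs.simple i) :
    X.codist x' y = cs.simple i * X.codist x y ∨ X.codist x' y = X.codist x y := by
  rcases cs.length_simple_mul (X.codist x y) i with hlt | hlt
  · obtain ⟨x'', h1, h2⟩ := X.exists_codist_pos_step x y i
    rcases X.pos.eq_or_δ_eq_simple h (X.pos.δ_eq_simple_symm h1) with rfl | h3
    · exact Or.inl h2
    · right
      have := X.codist_pos_step x'' x' y i h3 (by
        rw [h2, cs.simple_mul_simple_cancel_left]; omega)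
      rw [this, h2, cs.simple_mul_simple_cancel_left]
  · exact Or.inl (X.codist_pos_step x x' y i h (by omega))

theorem codist_neg_eq_or (x : P) {y y' : N} {i : I} (h : X.neg.δ y' y = cs.simple i) :
    X.codist x y' = X.codist x y * cs.simple i ∨ X.codist x y' = X.codist x y := by
  rcases cs.length_mul_simple (X.codist x y) i with hlt | hlt
  · obtain ⟨y'', h1, h2⟩ := X.exists_codist_neg_step x y i
    rcases X.neg.eq_or_δ_eq_simple h (X.neg.δ_eq_simple_symm h1) with rfl | h3
    · exact Or.inl h2
    · right
      have := X.codist_neg_step x y'' y' i h3 (by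
        rw [h2, cs.simple_mul_simple_cancel_right]; omega)
      rw [this, h2, cs.simple_mul_simple_cancel_right]
  · exact Or.inl (X.codist_neg_step x y y' i h (by omega))

theorem codist_eq_one_of_pos {x x' : P} {y : N} {i : I} (h : X.pos.δ x' x = cs.simple i)
    (hc : X.codist x y = cs.simple i) : X.codist x' y = 1 := by
  have := X.codist_pos_step x x' y i h (by
    rw [hc, cs.simple_mul_simple_self, cs.length_one, cs.length_simple]; omega)
  rw [this, hc, cs.simple_mul_simple_self]

theorem codist_eq_one_of_neg {x : P} {y y' : N} {i : I} (h : X.neg.δ y' y = cs.simple i)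
    (hc : X.codist x y = cs.simple i) : X.codist x y' = 1 := by
  have := X.codist_neg_step x y y' i h (by
    rw [hc, cs.simple_mul_simple_self, cs.length_one, cs.length_simple]; omega)
  rw [this, hc, cs.simple_mul_simple_self]

/-- Along a gallery from `p` to `y` that shortens `δ(·, y)`, each step changes the length of the
codistance to `z` by at most one. -/
theorem length_codist_le (p y : P) (z : N) :
    cs.length (X.codist y z) ≤ cs.length (X.pos.δ p y) + cs.length (X.codist p z) := by
  induction hn : cs.length (X.pos.δ p y) using Nat.strong_induction_on generalizing p with
  | _ n ih =>
    by_cases h : p = y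
    · subst h; omega
    · obtain ⟨i, p', h1, -, h3⟩ := X.pos.exists_δ_step_lt h
      have h4 := ih _ (hn ▸ h3) p' rfl
      have h5 : cs.length (X.codist p' z) ≤ cs.length (X.codist p z) + 1 := by
        rcases X.codist_pos_eq_or z h1 with h | h
        · rw [h]
          rcases cs.length_simple_mul (X.codist p z) i with h | h <;> omega
        · rw [h]; omega
      omega

/-- Moving the negative chamber of an opposite pair `(p, z)` to `z'`, the positive chamber can
follow while its distance to a fixed chamber `y` keeps recording the codistance of `y`. -/
theorem exists_follow {y p : P} {z z' : N} {i : I} (hp : X.pos.δ p y = (X.codist y z)⁻¹)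
    (ho : X.codist p z = 1) (hz : X.neg.δ z' z = cs.simple i) :
    ∃ p', X.pos.SAdjacent i p p' ∧ X.pos.δ p' y = (X.codist y z')⁻¹ ∧ X.codist p' z' = 1 := by
  -- If `p` were opposite `z''`, `length_codist_le` would bound the codistance of `y` and `z''` by
  -- the length of `δ(p, y)`, which is that for `z`.
  have key : ∀ z'', X.neg.δ z'' z = cs.simple i →
      cs.length (X.codist y z) < cs.length (X.codist y z'') → X.codist p z'' = cs.simple i := by
    intro z'' h1 h2
    rcases X.codist_neg_eq_or p h1 with h | h
    · rw [h, ho, one_mul]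
    · have := X.length_codist_le p y z''
      rw [h, ho, cs.length_one, hp, cs.length_inv] at this
      omega
  have hstep : ∃ p', X.pos.δ p' p = cs.simple i ∧
      X.pos.δ p' y = (X.codist y z * cs.simple i)⁻¹ := by
    obtain ⟨p', h1, h2⟩ := X.pos.exists_δ_step p y i
    exact ⟨p', h1, by rw [h2, hp, mul_inv_rev, cs.inv_simple]⟩
  obtain ⟨p', h1, h2⟩ := hstep
  have hadj : X.pos.SAdjacent i p p' := Or.inr (X.pos.δ_eq_simple_symm h1)
  rcases cs.length_mul_simple (X.codist y z) i with hlt | hlt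
  · rcases X.codist_neg_eq_or y hz with h | h
    · refine ⟨p', hadj, by rw [h2, h], X.codist_eq_one_of_pos h1 (key z' hz ?_)⟩
      rw [h]; omega
    -- Here `p` stays put: the panel contains a chamber `z'' ≠ z'` at codistance `s` from `p`, so
    -- `z'` is opposite `p`.
    · refine ⟨p, Or.inl rfl, by rw [hp, h], ?_⟩
      obtain ⟨z'', h3, h4⟩ := X.exists_codist_neg_step y z i
      have h5 := key z'' h3 (by rw [h4]; omega)
      rcases X.neg.eq_or_δ_eq_simple hz (X.neg.δ_eq_simple_symm h3) with rfl | h6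
      · rw [← h4, h] at hlt; omega
      · exact X.codist_eq_one_of_neg h6 h5
  · have hz' := X.codist_neg_step y z z' i hz (by omega)
    refine ⟨p', hadj, by rw [h2, hz'], X.codist_eq_one_of_neg hz ?_⟩
    -- `p'` is too close to `y` to be opposite `z`, so its codistance to `z` is `s`.
    rcases X.codist_pos_eq_or z h1 with h | h
    · rw [h, ho, mul_one]
    · have := X.length_codist_le p' y z
      rw [h, ho, cs.length_one, h2, cs.length_inv] at this
      omega

/-- Chains of length `n` of opposite pairs, consecutive ones being adjacent. -/
inductive OppChain (X : TwinBuilding cs P N) : ℕ → P × N → P × N → Prop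
  | refl (a : P × N) (ha : X.Opp a) : OppChain X 0 a a
  | cons {n : ℕ} {a b c : P × N} (ha : X.Opp a) (hab : X.Adjacent a b)
      (hbc : OppChain X n b c) : OppChain X (n + 1) a c

variable {X}

theorem OppChain.opp_left {n : ℕ} {a b : P × N} (h : X.OppChain n a b) : X.Opp a := by
  cases h <;> assumption

theorem OppChain.eq_of_zero {a b : P × N} (h : X.OppChain 0 a b) : a = b := by
  cases h; rfl

theorem OppChain.trans {m n : ℕ} {a b c : P × N} (h : X.OppChain m a b)
    (h' : X.OppChain n b c) : X.OppChain (m + n) a c := by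
  induction h with
  | refl a ha => simpa using h'
  | @cons k a b d ha hab hbd ih =>
    rw [Nat.add_right_comm]
    exact .cons ha hab (ih h')

variable (X)

theorem exists_oppChain_pos {x y : P} (p : X.pos.chamberGraph.Walk x y) (z : N)
    (h : X.codist x z = 1) :
    ∃ z', X.OppChain p.length (x, z) (y, z') ∧ X.neg.dist z z' ≤ p.length ∧
      X.codist y z' = 1 := by
  induction p generalizing z with
  | nil => exact ⟨z, .refl _ h, by simp [X.neg.dist_self], h⟩
  | @cons u v w huv q ih =>
    obtain ⟨i, hi⟩ := X.pos.chamberGraph_adj_iff.1 huv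
    have hvu := X.pos.δ_eq_simple_symm hi
    have hstep : ∃ z₁, X.neg.SAdjacent i z z₁ ∧ X.codist v z₁ = 1 := by
      rcases X.codist_pos_eq_or z hvu with h' | h'
      · obtain ⟨z₁, h1, h2⟩ := X.exists_codist_neg_step v z i
        refine ⟨z₁, Or.inr (X.neg.δ_eq_simple_symm h1), ?_⟩
        rw [h2, h', h, mul_one, cs.simple_mul_simple_self]
      · exact ⟨z, Or.inl rfl, h'.trans h⟩
    obtain ⟨z₁, h1, h2⟩ := hstep
    obtain ⟨z', h3, h4, h5⟩ := ih z₁ h2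
    refine ⟨z', .cons h ⟨i, Or.inr hi, h1⟩ h3, ?_, h5⟩
    have := X.neg.dist_triangle z z₁ z'
    have := X.neg.dist_le_one_of_sAdjacent h1
    rw [SimpleGraph.Walk.length_cons]
    omega

/-- The relation between `p` and `y` is carried along because it forces `p' = y` once `z'` is
opposite `y`. -/
theorem exists_oppChain_neg {y : P} {z z' : N} (q : X.neg.chamberGraph.Walk z z') (p : P)
    (hp : X.pos.δ p y = (X.codist y z)⁻¹) (ho : X.codist p z = 1) :
    ∃ p', X.OppChain q.length (p, z) (p', z') ∧ X.pos.δ p' y = (X.codist y z')⁻¹ := by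
  induction q generalizing p with
  | nil => exact ⟨p, .refl _ ho, hp⟩
  | @cons u v w huv q ih =>
    obtain ⟨i, hi⟩ := X.neg.chamberGraph_adj_iff.1 huv
    obtain ⟨p₁, h1, h2, h3⟩ := X.exists_follow hp ho (X.neg.δ_eq_simple_symm hi)
    obtain ⟨p', h4, h5⟩ := ih p₁ h2 h3
    exact ⟨p', .cons ho ⟨i, h1, Or.inr hi⟩ h4, h5⟩

/-- Any two opposite pairs are joined by a chain of opposite pairs of length at most twice their
distance. -/
theorem exists_oppChain {a b : P × N} (ha : X.Opp a) (hb : X.Opp b) :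
    ∃ n, n ≤ 2 * X.dist a b ∧ X.OppChain n a b := by
  obtain ⟨x, z⟩ := a
  obtain ⟨y, z'⟩ := b
  obtain ⟨p, hp⟩ := X.pos.exists_walk_length_eq_dist x y
  obtain ⟨z₁, h1, h2, h3⟩ := X.exists_oppChain_pos p z ha
  obtain ⟨q, hq⟩ := X.neg.exists_walk_length_eq_dist z₁ z'
  obtain ⟨y', h4, h5⟩ := X.exists_oppChain_neg (y := y) q y (by rw [h3, X.pos.δ_self, inv_one]) h3
  have hb' : X.codist y z' = 1 := hb
  rw [hb', inv_one, X.pos.δ_eq_one_iff] at h5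
  subst h5
  refine ⟨_, ?_, h1.trans h4⟩
  -- The chain has length `d(x, y) + d(z₁, z') ≤ 2 d(x, y) + d(z, z')`.
  have h6 := X.neg.dist_triangle z₁ z z'
  rw [X.neg.dist_comm z₁ z] at h6
  simp only [dist]
  omega

theorem dist_triangle (a b c : P × N) : X.dist a c ≤ X.dist a b + X.dist b c := by
  have := X.pos.dist_triangle a.1 b.1 c.1
  have := X.neg.dist_triangle a.2 b.2 c.2
  simp only [dist]
  omega

theorem dist_self (a : P × N) : X.dist a a = 0 := by
  simp [dist, X.pos.dist_self, X.neg.dist_self]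

variable {X}

theorem Adjacent.symm {a b : P × N} (h : X.Adjacent a b) : X.Adjacent b a :=
  h.imp fun _ hi => ⟨hi.1.symm, hi.2.symm⟩

theorem Adjacent.dist_le {a b : P × N} (h : X.Adjacent a b) : X.dist a b ≤ 2 := by
  obtain ⟨i, h1, h2⟩ := h
  have := X.pos.dist_le_one_of_sAdjacent h1
  have := X.neg.dist_le_one_of_sAdjacent h2
  simp only [dist]
  omega

theorem adjacent_self [Nonempty I] (a : P × N) : X.Adjacent a a :=
  ⟨Classical.arbitrary I, Or.inl rfl, Or.inl rfl⟩

/-! ### Group actions: from chains to words. -/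

variable (X)

/-- The group `Γ` acts on `X` by automorphisms that preserve the two Weyl distances. -/
structure IsDistPreserving (Γ : Type*) [Group Γ] [MulAction Γ P] [MulAction Γ N] : Prop where
  δ_pos : ∀ (g : Γ) (x y : P), X.pos.δ (g • x) (g • y) = X.pos.δ x y
  δ_neg : ∀ (g : Γ) (x y : N), X.neg.δ (g • x) (g • y) = X.neg.δ x y

namespace IsDistPreserving

variable {X} {Γ : Type*} [Group Γ] [MulAction Γ P] [MulAction Γ N]

theorem dist_smul (h : X.IsDistPreserving Γ) (g : Γ) (a b : P × N) :
    X.dist (g • a) (g • b) = X.dist a b := by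
  simp only [TwinBuilding.dist, Prod.smul_fst, Prod.smul_snd, X.pos.dist_smul h.δ_pos,
    X.neg.dist_smul h.δ_neg]

theorem adjacent_smul (h : X.IsDistPreserving Γ) (g : Γ) (a b : P × N) :
    X.Adjacent (g • a) (g • b) ↔ X.Adjacent a b := by
  simp only [Adjacent, Building.SAdjacent, Prod.smul_fst, Prod.smul_snd, h.δ_pos, h.δ_neg,
    smul_left_cancel_iff]

theorem adjacent_smul_self_of_mem (h : X.IsDistPreserving Γ) {c : P × N} {a : Γ}
    (ha : a ∈ X.adaptedGenerators Γ c ∨ a⁻¹ ∈ X.adaptedGenerators Γ c) :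
    X.Adjacent c (a • c) := by
  rcases ha with ha | ha
  · exact ha.symm
  · have := (h.adjacent_smul a (a⁻¹ • c) c).2 ha
    rwa [smul_inv_smul] at this

theorem dist_prod_smul_le (h : X.IsDistPreserving Γ) (c : P × N) (l : List Γ)
    (hl : ∀ a ∈ l, a ∈ X.adaptedGenerators Γ c ∨ a⁻¹ ∈ X.adaptedGenerators Γ c) :
    X.dist c (l.prod • c) ≤ 2 * l.length := by
  induction l with
  | nil => simp [X.dist_self]
  | cons a l ih =>
    have h1 := ih fun b hb => hl b (List.mem_cons_of_mem a hb)
    have h2 := (h.adjacent_smul_self_of_mem (hl a List.mem_cons_self)).dist_le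
    have h3 := X.dist_triangle c (a • c) ((a * l.prod) • c)
    rw [mul_smul, h.dist_smul] at h3
    rw [List.prod_cons, List.length_cons, mul_smul]
    omega

/-- If `Γ` is transitive on opposite pairs, chains of opposite pairs yield words in the adapted
generators. -/
theorem exists_word_of_oppChain (h : X.IsDistPreserving Γ) {c : P × N}
    (htrans : ∀ a, X.Opp a → ∃ g : Γ, g • c = a) {n : ℕ} {a b : P × N} (hab : X.OppChain n a b)
    (hn : n ≠ 0) (g k : Γ) (hg : g • c = a) (hk : k • c = b) :
    ∃ l : List Γ, (∀ x ∈ l, x ∈ X.adaptedGenerators Γ c) ∧ l.prod = g⁻¹ * k ∧ l.length = n := by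
  induction hab generalizing g with
  | refl => exact absurd rfl hn
  | @cons n a b d ha hab hbd ih =>
    have key : ∀ j : Γ, j • c = b → g⁻¹ * j ∈ X.adaptedGenerators Γ c := by
      intro j hj
      have := (h.adjacent_smul g⁻¹ a b).2 hab
      rw [← hg, inv_smul_smul, ← hj, ← mul_smul] at this
      exact this.symm
    -- The last link must end at the prescribed `k`, not at an arbitrary element carrying `c` to the
    -- endpoint; this absorbs the stabilizer of `c` and requires at least one link.
    by_cases hn : n = 0
    · subst hn
      refine ⟨[g⁻¹ * k], ?_, by simp, rfl⟩
      simpa using key k (hk.trans hbd.eq_of_zero.symm)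
    · obtain ⟨j, hj⟩ := htrans b hbd.opp_left
      obtain ⟨l, h1, h2, h3⟩ := ih hn j hj hk
      refine ⟨(g⁻¹ * j) :: l, ?_, ?_, by simp [h3]⟩
      · intro x hx
        rcases List.mem_cons.1 hx with rfl | hx
        · exact key j hj
        · exact h1 x hx
      · rw [List.prod_cons, h2]; group

theorem exists_word_of_smul_ne (h : X.IsDistPreserving Γ) {c : P × N}
    (htrans : ∀ a, X.Opp a → ∃ g : Γ, g • c = a) (hopp : ∀ g : Γ, X.Opp (g • c)) {γ : Γ}
    (hγ : γ • c ≠ c) :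
    ∃ l : List Γ, (∀ x ∈ l, x ∈ X.adaptedGenerators Γ c) ∧ l.prod = γ ∧
      l.length ≤ 2 * X.dist c (γ • c) := by
  obtain ⟨n, hn, hchain⟩ := X.exists_oppChain (one_smul Γ c ▸ hopp 1) (hopp γ)
  have hn0 : n ≠ 0 := by
    rintro rfl
    exact hγ hchain.eq_of_zero.symm
  obtain ⟨l, h1, h2, h3⟩ :=
    h.exists_word_of_oppChain htrans hchain hn0 1 γ (one_smul Γ c) rfl
  exact ⟨l, h1, by simpa using h2, h3 ▸ hn⟩

end IsDistPreserving

theorem mem_adaptedGenerators_of_smul_eq [Nonempty I] {Γ : Type*} [Group Γ] [MulAction Γ P]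
    [MulAction Γ N] {c : P × N} {γ : Γ} (h : γ • c = c) : γ ∈ X.adaptedGenerators Γ c := by
  change X.Adjacent (γ • c) c
  rw [h]
  exact adjacent_self c

end TwinBuilding

/-! ### Transitivity on opposite pairs from the root group datum. -/

namespace RootGroupDatum.IsAssociated

variable {I W : Type*} [Group W] {M : CoxeterMatrix I} {cs : CoxeterSystem M W}
  {Γ : Type*} [Group Γ] {R : RootGroupDatum cs Γ} {P N : Type*} [MulAction Γ P] [MulAction Γ N]
  {X : TwinBuilding cs P N} {o : P × N}

theorem isDistPreserving (hX : R.IsAssociated X o) : X.IsDistPreserving Γ where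
  δ_pos g x y := by
    obtain ⟨a, rfl⟩ := hX.exists_smul_pos x
    obtain ⟨b, rfl⟩ := hX.exists_smul_pos y
    rw [← mul_smul, ← mul_smul, hX.δ_pos, mul_inv_rev, mul_assoc, inv_mul_cancel_left,
      ← hX.δ_pos]
  δ_neg g x y := by
    obtain ⟨a, rfl⟩ := hX.exists_smul_neg x
    obtain ⟨b, rfl⟩ := hX.exists_smul_neg y
    rw [← mul_smul, ← mul_smul, hX.δ_neg, mul_inv_rev, mul_assoc, inv_mul_cancel_left,
      ← hX.δ_neg]

theorem codist_smul (hX : R.IsAssociated X o) (g : Γ) (x : P) (y : N) :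
    X.codist (g • x) (g • y) = X.codist x y := by
  obtain ⟨a, rfl⟩ := hX.exists_smul_pos x
  obtain ⟨b, rfl⟩ := hX.exists_smul_neg y
  rw [← mul_smul, ← mul_smul, hX.codist, mul_inv_rev, mul_assoc, inv_mul_cancel_left,
    ← hX.codist]

/-- A product of several `m(u)` may represent 1 without visibly lying in `T`; but `δ(o₊, n o₊) = 1`,
so `n` fixes `o₊`. -/
theorem mem_Bpos_of_represents_one (hX : R.IsAssociated X o) {n : Γ} (hn : R.Represents n 1) :
    n ∈ R.Bpos := by
  have h := (hX.δ_pos 1 n 1).2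
    ⟨1, one_mem _, n, hn, 1, one_mem _, by simp⟩
  rw [X.pos.δ_eq_one_iff, one_smul] at h
  rw [← hX.stabilizer_pos]
  exact h.symm

/-- `Γ` is transitive on the pairs of opposite chambers. -/
theorem exists_smul_eq_of_opp (hX : R.IsAssociated X o) {a : P × N} (ha : X.Opp a) :
    ∃ g : Γ, g • o = a := by
  obtain ⟨x, y⟩ := a
  obtain ⟨g, rfl⟩ := hX.exists_smul_pos x
  obtain ⟨h, rfl⟩ := hX.exists_smul_neg y
  obtain ⟨b, hb, n, hn, b', hb', heq⟩ := (hX.codist g h 1).1 ha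
  have hbn : b * n ∈ MulAction.stabilizer Γ o.1 :=
    hX.stabilizer_pos ▸ mul_mem hb (hX.mem_Bpos_of_represents_one hn)
  rw [← hX.stabilizer_neg] at hb'
  refine ⟨g * (b * n), Prod.ext ?_ ?_⟩
  · change (g * (b * n)) • o.1 = g • o.1
    rw [mul_smul, MulAction.mem_stabilizer_iff.1 hbn]
  · change (g * (b * n)) • o.2 = h • o.2
    have : h = g * (b * n) * b' := by rw [mul_assoc, ← heq, mul_inv_cancel_left]
    rw [this, mul_smul _ b', MulAction.mem_stabilizer_iff.1 hb']

end RootGroupDatum.IsAssociated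

/-! ### Word length and the main theorem. -/

theorem wordLength_le_length {Γ : Type*} [Group Γ] {A : Set Γ} {l : List Γ}
    (hl : ∀ a ∈ l, a ∈ A) : wordLength A l.prod ≤ l.length :=
  Nat.sInf_le ⟨l, fun a ha => Or.inl (hl a ha), rfl, rfl⟩

/-- The given word `l` ensures that the infimum is attained and is not the default value 0 of `sInf
∅`. -/
theorem exists_word_length_eq_wordLength {Γ : Type*} [Group Γ] {A : Set Γ} {g : Γ} {l : List Γ}
    (hl : ∀ a ∈ l, a ∈ A) (hg : l.prod = g) :
    ∃ l' : List Γ, (∀ a ∈ l', a ∈ A ∨ a⁻¹ ∈ A) ∧ l'.prod = g ∧ l'.length = wordLength A g :=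
  Nat.sInf_mem (s := {n | ∃ l : List Γ, (∀ a ∈ l, a ∈ A ∨ a⁻¹ ∈ A) ∧ l.prod = g ∧ l.length = n})
    ⟨_, l, fun a ha => Or.inl (hl a ha), hg, rfl⟩

theorem mainTheorem2 {I W : Type*} [Nonempty I] [Group W] {M : CoxeterMatrix I}
    (cs : CoxeterSystem M W) {Γ : Type*} [Group Γ] (R : RootGroupDatum cs Γ)
    {P N : Type*} [MulAction Γ P] [MulAction Γ N] (X : TwinBuilding cs P N)
    (o : P × N) (hX : R.IsAssociated X o) (c : P × N) (hc : X.Opp c) :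
    Subgroup.closure (X.adaptedGenerators Γ c) = ⊤ ∧
    (∀ γ : Γ,
      (1 / 2 : ℝ) * X.dist c (γ • c) ≤ wordLength (X.adaptedGenerators Γ c) γ ∧
      (γ • c ≠ c →
        (wordLength (X.adaptedGenerators Γ c) γ : ℝ) ≤ 2 * X.dist c (γ • c)) ∧
      (γ • c = c → wordLength (X.adaptedGenerators Γ c) γ ≤ 1)) ∧
    IsQuasiIsometricEmbedding
      (fun γ γ' : Γ => (wordLength (X.adaptedGenerators Γ c) (γ⁻¹ * γ') : ℝ))
      (fun x y : P × N => (X.dist x y : ℝ))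
      (fun γ : Γ => γ • c) := by
  have hD := hX.isDistPreserving
  have htrans : ∀ a, X.Opp a → ∃ g : Γ, g • c = a := by
    intro a ha
    obtain ⟨g, rfl⟩ := hX.exists_smul_eq_of_opp ha
    obtain ⟨k, rfl⟩ := hX.exists_smul_eq_of_opp hc
    exact ⟨g * k⁻¹, by rw [mul_smul, inv_smul_smul]⟩
  have hopp : ∀ g : Γ, X.Opp (g • c) := fun g => (hX.codist_smul g c.1 c.2).trans hc
  have hword : ∀ γ : Γ, ∃ l : List Γ, (∀ x ∈ l, x ∈ X.adaptedGenerators Γ c) ∧ l.prod = γ := by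
    intro γ
    by_cases h : γ • c = c
    · exact ⟨[γ], by simpa using X.mem_adaptedGenerators_of_smul_eq h, by simp⟩
    · obtain ⟨l, h1, h2, -⟩ := hD.exists_word_of_smul_ne htrans hopp h
      exact ⟨l, h1, h2⟩
  have hlower : ∀ γ : Γ, X.dist c (γ • c) ≤ 2 * wordLength (X.adaptedGenerators Γ c) γ := by
    intro γ
    obtain ⟨l, h1, h2⟩ := hword γ
    obtain ⟨l', h3, h4, h5⟩ := exists_word_length_eq_wordLength h1 h2
    rw [← h5, ← h4]
    exact hD.dist_prod_smul_le c l' h3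
  have hupper : ∀ γ : Γ, γ • c ≠ c →
      wordLength (X.adaptedGenerators Γ c) γ ≤ 2 * X.dist c (γ • c) := by
    intro γ h
    obtain ⟨l, h1, h2, h3⟩ := hD.exists_word_of_smul_ne htrans hopp h
    exact (h2 ▸ wordLength_le_length h1).trans h3
  have hfix : ∀ γ : Γ, γ • c = c → wordLength (X.adaptedGenerators Γ c) γ ≤ 1 := by
    intro γ h
    simpa using wordLength_le_length (l := [γ])
      (by simpa using X.mem_adaptedGenerators_of_smul_eq h)
  -- `L = 2` serves both bounds; `A = 1` accounts for the elements fixing `c`, whose word length is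
  -- at most 1.
  refine ⟨?_, fun γ => ⟨?_, fun h => mod_cast hupper γ h, hfix γ⟩, 2, 1, by norm_num, by norm_num,
    fun γ γ' => ?_⟩
  · refine eq_top_iff.2 fun γ _ => ?_
    obtain ⟨l, h1, rfl⟩ := hword γ
    exact Subgroup.list_prod_mem _ fun x hx => Subgroup.subset_closure (h1 x hx)
  · have : (X.dist c (γ • c) : ℝ) ≤ 2 * wordLength (X.adaptedGenerators Γ c) γ :=
      mod_cast hlower γ
    linarith
  · have hdist : X.dist (γ • c) (γ' • c) = X.dist c ((γ⁻¹ * γ') • c) := by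
      rw [← hD.dist_smul γ c, ← mul_smul, mul_inv_cancel_left]
    have h1 : (X.dist c ((γ⁻¹ * γ') • c) : ℝ) ≤
        2 * wordLength (X.adaptedGenerators Γ c) (γ⁻¹ * γ') := mod_cast hlower _
    have h2 : (wordLength (X.adaptedGenerators Γ c) (γ⁻¹ * γ') : ℝ) ≤
        2 * X.dist c ((γ⁻¹ * γ') • c) + 1 := by
      by_cases h : (γ⁻¹ * γ') • c = c
      · have := hfix _ h
        exact_mod_cast this.trans (Nat.le_add_left 1 _)
      · exact_mod_cast (hupper _ h).trans (Nat.le_succ _)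
    simp only [hdist]
    constructor <;> linarith
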